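/- Let $x_0>0$ be a real number and let $x_n=\arctan(x_{n-1})$ for every integer $n\ge 1$. Then there is a real constant $C$, depending only on the initial value $x_0$, such that, as $n\to\infty$, \begin{align*} \frac{x_n}{\sqrt{3/2}} ={}& \frac{1}{n^{1/2}}+\frac{3}{40}\frac{\ln n}{n^{3/2}}+\frac{C}{2}\frac{1}{n^{3/2}}+\frac{27}{3200}\frac{(\ln n)^2}{n^{5/2}}+\left(\frac{9}{80}C-\frac{9}{800}\right)\frac{\ln n}{n^{5/2}}\\ &+\left(\frac38C^2-\frac{3}{40}C+\frac{47}{5600}\right)\frac{1}{n^{5/2}}+\frac{27}{25600}\frac{(\ln n)^3}{n^{7/2}}+\left(\frac{27}{1280}C-\frac{27}{8000}\right)\frac{(\ln n)^2}{n^{7/2}}\\ &+\left(\frac{9}{64}C^2-\frac{9}{200}C+\frac{1083}{224000}\right)\frac{\ln n}{n^{7/2}}+\left(\frac{5}{16}C^3-\frac{3}{20}C^2+\frac{361}{11200}C-\frac{261}{224000}\right)\frac{1}{n^{7/2}}\\ &+\frac{567}{4096000}\frac{(\ln n)^4}{n^{9/2}}+\left(\frac{189}{51200}C-\frac{1917}{2560000}\right)\frac{(\ln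 n)^3}{n^{9/2}}\\ &+\left(\frac{189}{5120}C^2-\frac{1917}{128000}C+\frac{909}{512000}\right)\frac{(\ln n)^2}{n^{9/2}}\\ &+\left(\frac{21}{128}C^3-\frac{639}{6400}C^2+\frac{303}{12800}C-\frac{11979}{8960000}\right)\frac{\ln n}{n^{9/2}}\\ &+\left(\frac{35}{128}C^4-\frac{71}{320}C^3+\frac{101}{1280}C^2-\frac{3993}{448000}C-\frac{44217}{689920000}\right)\frac{1}{n^{9/2}}+o\!\left(\frac{1}{n^{9/2}}\right). \end{align*} -/

import Mathlib

open Real Filter Topology Asymptotics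

/-- The explicit expansion in powers `n ^ (-1/2), n ^ (-3/2), …, n ^ (-9/2)`, whose coefficients are
polynomials in `log n` and in the constant `C`. -/
noncomputable def arctanExpansion (C : ℝ) (n : ℕ) : ℝ :=
  1 / (n : ℝ) ^ (1 / 2 : ℝ)
  + 3 / 40 * (log n / (n : ℝ) ^ (3 / 2 : ℝ))
  + C / 2 * (1 / (n : ℝ) ^ (3 / 2 : ℝ))
  + 27 / 3200 * (log n ^ 2 / (n : ℝ) ^ (5 / 2 : ℝ))
  + (9 / 80 * C - 9 / 800) * (log n / (n : ℝ) ^ (5 / 2 : ℝ))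
  + (3 / 8 * C ^ 2 - 3 / 40 * C + 47 / 5600) * (1 / (n : ℝ) ^ (5 / 2 : ℝ))
  + 27 / 25600 * (log n ^ 3 / (n : ℝ) ^ (7 / 2 : ℝ))
  + (27 / 1280 * C - 27 / 8000) * (log n ^ 2 / (n : ℝ) ^ (7 / 2 : ℝ))
  + (9 / 64 * C ^ 2 - 9 / 200 * C + 1083 / 224000) * (log n / (n : ℝ) ^ (7 / 2 : ℝ))
  + (5 / 16 * C ^ 3 - 3 / 20 * C ^ 2 + 361 / 11200 * C - 261 / 224000)
      * (1 / (n : ℝ) ^ (7 / 2 : ℝ))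
  + 567 / 4096000 * (log n ^ 4 / (n : ℝ) ^ (9 / 2 : ℝ))
  + (189 / 51200 * C - 1917 / 2560000) * (log n ^ 3 / (n : ℝ) ^ (9 / 2 : ℝ))
  + (189 / 5120 * C ^ 2 - 1917 / 128000 * C + 909 / 512000)
      * (log n ^ 2 / (n : ℝ) ^ (9 / 2 : ℝ))
  + (21 / 128 * C ^ 3 - 639 / 6400 * C ^ 2 + 303 / 12800 * C - 11979 / 8960000)
      * (log n / (n : ℝ) ^ (9 / 2 : ℝ))
  + (35 / 128 * C ^ 4 - 71 / 320 * C ^ 3 + 101 / 1280 * C ^ 2 - 3993 / 448000 * C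
      - 44217 / 689920000) * (1 / (n : ℝ) ^ (9 / 2 : ℝ))

/-! In the coordinate `u = 3 / (2 x ^ 2)` the map `arctan` is nearly the translation `u ↦ u + 1`.
The corrections in `abelFun` (call it `F`) cancel the error to the order needed: one step changes
`F` by `1 + O(x ^ 10)` (`abelFun_arctan_step_isBigO`). A Cesàro argument gives `u n ~ n`, hence `x n
^ 2 = O(1 / n)`. The step errors are then `O(n⁻⁵)`, and summing them gives `F (u n) = n + K +
O(n⁻⁴)`.

Conversely, let `v n = 3 / (2 y ^ 2)`, where `y` is `√(3/2)` times the claimed expansion with `C =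
-K`. Its coefficients are those for which `F (v n) = n + K + o(n⁻³)`
(`abelFun_expansion_isLittleO`). Since `F` is expanding near infinity, `u n - v n = o(n⁻³)`.
Returning to `x` gains a factor `O(n ^ (-3/2))`, which gives the error `o(n ^ (-9/2))`. -/

/-! ### Taylor estimates for `arctan` and `log`. -/

theorem abs_arctan_sub_taylor_le {x : ℝ} (hx : 0 ≤ x) :
    |arctan x - (x - x ^ 3 / 3 + x ^ 5 / 5 - x ^ 7 / 7 + x ^ 9 / 9 - x ^ 11 / 11)| ≤ x ^ 13 := by
  -- The remainder has derivative `y ^ 12 / (1 + y ^ 2)`, which lies between `0` and `y ^ 12`;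
  -- integrating by monotonicity puts it between `0` and `x ^ 13 / 13`.
  have hder : ∀ y : ℝ, HasDerivAt
      (fun y => arctan y - (y - y ^ 3 / 3 + y ^ 5 / 5 - y ^ 7 / 7 + y ^ 9 / 9 - y ^ 11 / 11))
      (y ^ 12 / (1 + y ^ 2)) y := by
    intro y
    have h := (hasDerivAt_arctan y).sub ((((((hasDerivAt_id' y).sub
      ((hasDerivAt_pow 3 y).div_const 3)).add ((hasDerivAt_pow 5 y).div_const 5)).sub
      ((hasDerivAt_pow 7 y).div_const 7)).add ((hasDerivAt_pow 9 y).div_const 9)).sub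
      ((hasDerivAt_pow 11 y).div_const 11))
    refine h.congr_deriv ?_
    have : 1 + y ^ 2 ≠ 0 := by positivity
    norm_num
    field_simp
    ring
  have hlow : Monotone
      (fun y => arctan y - (y - y ^ 3 / 3 + y ^ 5 / 5 - y ^ 7 / 7 + y ^ 9 / 9 - y ^ 11 / 11)) :=
    monotone_of_deriv_nonneg (fun y => (hder y).differentiableAt)
      fun y => by rw [(hder y).deriv]; positivity
  have hder' : ∀ y : ℝ, HasDerivAt (fun y => y ^ 13 / 13 -
      (arctan y - (y - y ^ 3 / 3 + y ^ 5 / 5 - y ^ 7 / 7 + y ^ 9 / 9 - y ^ 11 / 11)))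
      (y ^ 14 / (1 + y ^ 2)) y := by
    intro y
    refine (((hasDerivAt_pow 13 y).div_const 13).sub (hder y)).congr_deriv ?_
    have : 1 + y ^ 2 ≠ 0 := by positivity
    norm_num
    field_simp
    ring
  have hupp : Monotone (fun y => y ^ 13 / 13 -
      (arctan y - (y - y ^ 3 / 3 + y ^ 5 / 5 - y ^ 7 / 7 + y ^ 9 / 9 - y ^ 11 / 11))) :=
    monotone_of_deriv_nonneg (fun y => (hder' y).differentiableAt)
      fun y => by rw [(hder' y).deriv]; positivity
  have h1 := hlow hx
  have h2 := hupp hx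
  norm_num at h1 h2
  rw [abs_le]
  constructor <;> nlinarith [pow_nonneg hx 13]

theorem log_one_add_taylor_isBigO (n : ℕ) :
    (fun w : ℝ => (∑ i ∈ Finset.range n, (-w) ^ (i + 1) / (i + 1)) + log (1 + w))
      =O[𝓝 0] fun w => w ^ (n + 1) := by
  refine IsBigO.of_bound 2 ?_
  filter_upwards [Metric.ball_mem_nhds (0 : ℝ) (by norm_num : (0 : ℝ) < 1 / 2)] with w hw
  rw [Metric.mem_ball, dist_zero_right, Real.norm_eq_abs] at hw
  have h := abs_log_sub_add_sum_range_le (x := -w) (by rw [abs_neg]; linarith) n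
  rw [sub_neg_eq_add, abs_neg] at h
  rw [Real.norm_eq_abs, Real.norm_eq_abs, abs_pow]
  refine h.trans ?_
  rw [div_le_iff₀ (by linarith)]
  nlinarith [pow_nonneg (abs_nonneg w) (n + 1)]

/-! ### The approximate Abel function and its one-step error. -/

/-- An approximate Abel function for the iteration of `arctan` in the coordinate `3 / (2 x ^ 2)`. -/
noncomputable def abelFun (u : ℝ) : ℝ :=
  u + 3 / 20 * log u + 47 / 2800 / u + 3 / 16000 / u ^ 2 - 83723 / 86240000 / u ^ 3

/-- If the increments of a sequence are dominated by those of a null sequence, it converges at the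
corresponding rate. -/
theorem exists_limit_of_abs_sub_le_telescope {d g : ℕ → ℝ} {N : ℕ}
    (hg : Tendsto g atTop (𝓝 0)) (h : ∀ n ≥ N, |d (n + 1) - d n| ≤ g n - g (n + 1)) :
    ∃ K : ℝ, ∀ n ≥ N, |d n - K| ≤ g n := by
  have key : ∀ n ≥ N, ∀ m ≥ n, |d m - d n| ≤ g n - g m := by
    intro n hn m hm
    induction m, hm using Nat.le_induction with
    | base => simp
    | succ m hm ih =>
      have h1 := h m (hn.le.trans hm)
      have h2 := abs_add_le (d (m + 1) - d m) (d m - d n)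
      rw [sub_add_sub_cancel] at h2
      linarith
  -- By `key`, `g` is nonincreasing from `N` on, and its limit is `0`.
  have hnn : ∀ n ≥ N, 0 ≤ g n := by
    intro n hn
    refine le_of_tendsto hg ?_
    filter_upwards [eventually_ge_atTop n] with m hm
    have := (abs_nonneg _).trans (key n hn m hm)
    linarith
  have hc : CauchySeq fun n => d (n + N) := by
    refine cauchySeq_of_le_tendsto_0' (fun n => g (n + N)) (fun n m hnm => ?_)
      (hg.comp (tendsto_add_atTop_nat N))
    rw [dist_comm, Real.dist_eq]
    have := key (n + N) (by omega) (m + N) (by omega)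
    have := hnn (m + N) (by omega)
    linarith
  obtain ⟨K, hK⟩ := cauchySeq_tendsto_of_complete hc
  have hK' : Tendsto d atTop (𝓝 K) := (tendsto_add_atTop_iff_nat N).1 hK
  refine ⟨K, fun n hn => ?_⟩
  rw [abs_sub_comm]
  refine le_of_tendsto ((hK'.sub_const (d n)).abs) ?_
  filter_upwards [eventually_ge_atTop n] with m hm
  have := key n hn m hm
  have := hnn m (hn.le.trans hm)
  linarith

/-- Here `s = x ^ 2`, `q = (1 - arctan x / x) / x ^ 2`, and `p` is the Taylor polynomial of `q` in
`s`. At `q = p` the coefficients of `s ^ 0` to `s ^ 4` vanish; these five conditions fix the factor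
`3 / 2` and the constants of `abelFun`. Replacing `q` by `p` costs a multiple of `q - p`. -/
theorem abelFun_step_coeff (s q p : ℝ)
    (hp : p = 1 / 3 - s / 5 + s ^ 2 / 7 - s ^ 3 / 9 + s ^ 4 / 11) :
    3 / 2 * (2 * q + 3 * s * q ^ 2 + 4 * s ^ 2 * q ^ 3 + 5 * s ^ 3 * q ^ 4 + 6 * s ^ 4 * q ^ 5)
      + 3 / 10 * (s * q + s ^ 2 * q ^ 2 / 2 + s ^ 3 * q ^ 3 / 3 + s ^ 4 * q ^ 4 / 4)
      + 47 / 4200 * s * (-2 * s * q + s ^ 2 * q ^ 2)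
      + 1 / 12000 * s ^ 2 * (-4 * s * q + 6 * s ^ 2 * q ^ 2)
      + 83723 / 291060000 * s ^ 3 * (6 * s * q) - 1 =
      s ^ 5 * (22533683 / 103950000 + 21193649 / 212231250 * s - 354369413 / 3056130000 * s ^ 2
        + 1584299411 / 9338175000 * s ^ 3 - 59290125053 / 252130725000 * s ^ 4
        + 28990866859 / 100852290000 * s ^ 5 - 2314816919 / 8022341250 * s ^ 6
        + 129509422583 / 423579618000 * s ^ 7 - 7496698702 / 26473726125 * s ^ 8
        + 160385443271 / 679492303875 * s ^ 9 - 62992371359 / 349453184850 * s ^ 10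
        + 58916413951 / 465937579800 * s ^ 11 - 1298522461 / 16640627850 * s ^ 12
        + 292147223 / 6656251140 * s ^ 13 - 525152444 / 23534602245 * s ^ 14
        + 208649323 / 20919646440 * s ^ 15 - 31393 / 8301447 * s ^ 16 + 1175 / 922383 * s ^ 17
        - 5 / 14641 * s ^ 18 + 9 / 161051 * s ^ 19)
      + (q - p) * (3 / 2 * (2 + 3 * s * (q + p) + 4 * s ^ 2 * (q ^ 2 + q * p + p ^ 2)
          + 5 * s ^ 3 * (q ^ 3 + q ^ 2 * p + q * p ^ 2 + p ^ 3)
          + 6 * s ^ 4 * (q ^ 4 + q ^ 3 * p + q ^ 2 * p ^ 2 + q * p ^ 3 + p ^ 4))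
        + 3 / 10 * (s + s ^ 2 * (q + p) / 2 + s ^ 3 * (q ^ 2 + q * p + p ^ 2) / 3
          + s ^ 4 * (q ^ 3 + q ^ 2 * p + q * p ^ 2 + p ^ 3) / 4)
        + 47 / 4200 * s * (-2 * s + s ^ 2 * (q + p))
        + 1 / 12000 * s ^ 2 * (-4 * s + 6 * s ^ 2 * (q + p))
        + 83723 / 291060000 * s ^ 3 * (6 * s)) := by
  have h : 3 / 2 * (2 * p + 3 * s * p ^ 2 + 4 * s ^ 2 * p ^ 3 + 5 * s ^ 3 * p ^ 4 + 6 * s ^ 4 * p ^ 5)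
      + 3 / 10 * (s * p + s ^ 2 * p ^ 2 / 2 + s ^ 3 * p ^ 3 / 3 + s ^ 4 * p ^ 4 / 4)
      + 47 / 4200 * s * (-2 * s * p + s ^ 2 * p ^ 2)
      + 1 / 12000 * s ^ 2 * (-4 * s * p + 6 * s ^ 2 * p ^ 2)
      + 83723 / 291060000 * s ^ 3 * (6 * s * p) - 1 =
      s ^ 5 * (22533683 / 103950000 + 21193649 / 212231250 * s - 354369413 / 3056130000 * s ^ 2
        + 1584299411 / 9338175000 * s ^ 3 - 59290125053 / 252130725000 * s ^ 4
        + 28990866859 / 100852290000 * s ^ 5 - 2314816919 / 8022341250 * s ^ 6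
        + 129509422583 / 423579618000 * s ^ 7 - 7496698702 / 26473726125 * s ^ 8
        + 160385443271 / 679492303875 * s ^ 9 - 62992371359 / 349453184850 * s ^ 10
        + 58916413951 / 465937579800 * s ^ 11 - 1298522461 / 16640627850 * s ^ 12
        + 292147223 / 6656251140 * s ^ 13 - 525152444 / 23534602245 * s ^ 14
        + 208649323 / 20919646440 * s ^ 15 - 31393 / 8301447 * s ^ 16 + 1175 / 922383 * s ^ 17
        - 5 / 14641 * s ^ 18 + 9 / 161051 * s ^ 19) := by
    rw [hp]; ring
  rw [← h]; ring

/-- Since `arctan x = x * (1 - s * q)`, one step divides `u` by `(1 - s * q) ^ 2`. The increment is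
split exactly into its part of degree at most `4` in `s`, a multiple of `s ^ 5`, and the remainder
of the logarithm. -/
theorem abelFun_div_sq_sub (s q : ℝ) (hs : 0 < s) (hA : 1 - s * q ≠ 0) :
    abelFun (3 / 2 / s / (1 - s * q) ^ 2) - abelFun (3 / 2 / s) - 1 =
      3 / 2 * (2 * q + 3 * s * q ^ 2 + 4 * s ^ 2 * q ^ 3 + 5 * s ^ 3 * q ^ 4 + 6 * s ^ 4 * q ^ 5)
      + 3 / 10 * (s * q + s ^ 2 * q ^ 2 / 2 + s ^ 3 * q ^ 3 / 3 + s ^ 4 * q ^ 4 / 4)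
      + 47 / 4200 * s * (-2 * s * q + s ^ 2 * q ^ 2)
      + 1 / 12000 * s ^ 2 * (-4 * s * q + 6 * s ^ 2 * q ^ 2)
      + 83723 / 291060000 * s ^ 3 * (6 * s * q) - 1
      + s ^ 5 * (3 / 2 * q ^ 6 * (7 - 6 * (s * q)) * ((1 - s * q) ^ 2)⁻¹
        - 1 / 12000 * q ^ 3 * (4 - s * q)
        - 83723 / 291060000 * q ^ 2 *
          (15 - 20 * (s * q) + 15 * (s * q) ^ 2 - 6 * (s * q) ^ 3 + (s * q) ^ 4))
      - 3 / 10 * (s * q + (s * q) ^ 2 / 2 + (s * q) ^ 3 / 3 + (s * q) ^ 4 / 4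
        + log (1 - s * q)) := by
  have h0 : 3 / 2 / s ≠ 0 := by positivity
  have hlog : log (3 / 2 / s / (1 - s * q) ^ 2) = log (3 / 2 / s) - 2 * log (1 - s * q) := by
    rw [log_div h0 (pow_ne_zero 2 hA), log_pow]; norm_num
  have h1 : 3 / 2 / s / (1 - s * q) ^ 2 - 3 / 2 / s =
      3 / 2 * (2 * q + 3 * s * q ^ 2 + 4 * s ^ 2 * q ^ 3 + 5 * s ^ 3 * q ^ 4 + 6 * s ^ 4 * q ^ 5)
      + s ^ 5 * (3 / 2 * q ^ 6 * (7 - 6 * (s * q)) * ((1 - s * q) ^ 2)⁻¹) := by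
    field_simp
    ring
  have h2 : ∀ c : ℝ, c / (3 / 2 / s / (1 - s * q) ^ 2) - c / (3 / 2 / s) =
      c * (2 / 3) * s * (-2 * s * q + s ^ 2 * q ^ 2) := by
    intro c
    field_simp
    ring
  have h3 : ∀ c : ℝ, c / (3 / 2 / s / (1 - s * q) ^ 2) ^ 2 - c / (3 / 2 / s) ^ 2 =
      c * (4 / 9) * (s ^ 2 * (-4 * s * q + 6 * s ^ 2 * q ^ 2) - s ^ 5 * (q ^ 3 * (4 - s * q))) := by
    intro c
    field_simp
    ring
  have h4 : ∀ c : ℝ, c / (3 / 2 / s / (1 - s * q) ^ 2) ^ 3 - c / (3 / 2 / s) ^ 3 =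
      c * (8 / 27) * (-s ^ 3 * (6 * s * q) + s ^ 5 * (q ^ 2 *
          (15 - 20 * (s * q) + 15 * (s * q) ^ 2 - 6 * (s * q) ^ 3 + (s * q) ^ 4))) := by
    intro c
    field_simp
    ring
  unfold abelFun
  rw [hlog]
  linear_combination h1 + h2 (47 / 2800) + h3 (3 / 16000) - h4 (83723 / 86240000)

/-- One step of the iteration moves the approximate Abel function by `1`, up to `O(x ^ 10)`. -/
theorem abelFun_arctan_step_isBigO :
    (fun x : ℝ => abelFun (3 / 2 / arctan x ^ 2) - abelFun (3 / 2 / x ^ 2) - 1)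
      =O[𝓝[>] 0] fun x => x ^ 10 := by
  set l : Filter ℝ := 𝓝[>] (0 : ℝ) with hl
  let s : ℝ → ℝ := fun x => x ^ 2
  let q : ℝ → ℝ := fun x => (1 - arctan x / x) / x ^ 2
  let p : ℝ → ℝ := fun x => 1 / 3 - s x / 5 + s x ^ 2 / 7 - s x ^ 3 / 9 + s x ^ 4 / 11
  have hpos : ∀ᶠ x in l, 0 < x := self_mem_nhdsWithin
  have hx : Tendsto (fun x : ℝ => x) l (𝓝 0) := tendsto_id.mono_left nhdsWithin_le_nhds
  have hs : Tendsto s l (𝓝 0) := by simpa using hx.pow 2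
  have hp : Tendsto p l (𝓝 (1 / 3)) := by
    have h : Continuous fun s : ℝ => 1 / 3 - s / 5 + s ^ 2 / 7 - s ^ 3 / 9 + s ^ 4 / 11 := by
      fun_prop
    simpa [p, Function.comp_def] using (h.tendsto 0).comp hs
  -- The Taylor error `x ^ 13` divided by `x ^ 3` is exactly `s ^ 5`.
  have hqp : (fun x => q x - p x) =O[l] fun x => s x ^ 5 := by
    refine IsBigO.of_bound 1 ?_
    filter_upwards [hpos] with x hx
    have h := abs_arctan_sub_taylor_le hx.le
    have e : q x - p x =
        -(arctan x - (x - x ^ 3 / 3 + x ^ 5 / 5 - x ^ 7 / 7 + x ^ 9 / 9 - x ^ 11 / 11)) / x ^ 3 := by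
      simp only [q, p, s]
      field_simp
      ring
    rw [e, norm_div, norm_neg, Real.norm_eq_abs, Real.norm_eq_abs, Real.norm_eq_abs,
      abs_of_pos (pow_pos hx 3), one_mul, div_le_iff₀ (pow_pos hx 3),
      abs_of_pos (pow_pos (pow_pos hx 2) 5)]
    exact h.trans_eq (by ring)
  have hs5 : Tendsto (fun x => s x ^ 5) l (𝓝 0) := by simpa using hs.pow 5
  have hq : Tendsto q l (𝓝 (1 / 3)) := by
    have := (hqp.trans_tendsto hs5).add hp
    simpa using this
  have hsq : Tendsto (fun x => s x * q x) l (𝓝 0) := by simpa using hs.mul hq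
  have hA : ∀ᶠ x in l, 1 - s x * q x ≠ 0 := by
    have : Tendsto (fun x => 1 - s x * q x) l (𝓝 1) := by simpa using hsq.const_sub 1
    exact this.eventually_ne one_ne_zero
  have hinv : Tendsto (fun x => ((1 - s x * q x) ^ 2)⁻¹) l (𝓝 1) := by
    simpa using ((hsq.const_sub 1).pow 2).inv₀ (by norm_num)
  have hlog : (fun x => s x * q x + (s x * q x) ^ 2 / 2 + (s x * q x) ^ 3 / 3
      + (s x * q x) ^ 4 / 4 + log (1 - s x * q x)) =O[l] fun x => s x ^ 5 := by
    have h1 := (log_one_add_taylor_isBigO 4).comp_tendsto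
      (show Tendsto (fun x => -(s x * q x)) l (𝓝 0) by simpa using hsq.neg)
    have h2 : (fun x => (-(s x * q x)) ^ 5) =O[l] fun x => s x ^ 5 := by
      have h3 := (isBigO_refl (fun x => s x ^ 5) l).mul
        (((hq.pow 5).neg).isBigO_one ℝ)
      exact h3.congr (fun x => by ring) fun x => by ring
    refine (IsBigO.congr_left (h1.trans h2) fun x => ?_)
    simp [Finset.sum_range_succ, ← sub_eq_add_neg]
    norm_num
  -- All four arguments converge, so every cofactor that is continuous in them is bounded.
  have hbdd : ∀ Y : ℝ × ℝ × ℝ × ℝ → ℝ, Continuous Y →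
      (fun x => Y (s x, q x, p x, ((1 - s x * q x) ^ 2)⁻¹)) =O[l] fun _ => (1 : ℝ) := by
    intro Y hY
    exact ((hY.tendsto _).comp
      (hs.prodMk_nhds (hq.prodMk_nhds (hp.prodMk_nhds hinv)))).isBigO_one ℝ
  have hb1 := hbdd (fun z => (22533683 / 103950000 + 21193649 / 212231250 * z.1
        - 354369413 / 3056130000 * z.1 ^ 2
        + 1584299411 / 9338175000 * z.1 ^ 3 - 59290125053 / 252130725000 * z.1 ^ 4
        + 28990866859 / 100852290000 * z.1 ^ 5 - 2314816919 / 8022341250 * z.1 ^ 6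
        + 129509422583 / 423579618000 * z.1 ^ 7 - 7496698702 / 26473726125 * z.1 ^ 8
        + 160385443271 / 679492303875 * z.1 ^ 9 - 62992371359 / 349453184850 * z.1 ^ 10
        + 58916413951 / 465937579800 * z.1 ^ 11 - 1298522461 / 16640627850 * z.1 ^ 12
        + 292147223 / 6656251140 * z.1 ^ 13 - 525152444 / 23534602245 * z.1 ^ 14
        + 208649323 / 20919646440 * z.1 ^ 15 - 31393 / 8301447 * z.1 ^ 16 + 1175 / 922383 * z.1 ^ 17
        - 5 / 14641 * z.1 ^ 18 + 9 / 161051 * z.1 ^ 19)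
        + (3 / 2 * z.2.1 ^ 6 * (7 - 6 * (z.1 * z.2.1)) * z.2.2.2
        - 1 / 12000 * z.2.1 ^ 3 * (4 - z.1 * z.2.1)
        - 83723 / 291060000 * z.2.1 ^ 2 *
          (15 - 20 * (z.1 * z.2.1) + 15 * (z.1 * z.2.1) ^ 2 - 6 * (z.1 * z.2.1) ^ 3
            + (z.1 * z.2.1) ^ 4))) (by fun_prop)
  have hb2 := hbdd (fun z => (3 / 2 * (2 + 3 * z.1 * (z.2.1 + z.2.2.1)
          + 4 * z.1 ^ 2 * (z.2.1 ^ 2 + z.2.1 * z.2.2.1 + z.2.2.1 ^ 2)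
          + 5 * z.1 ^ 3 * (z.2.1 ^ 3 + z.2.1 ^ 2 * z.2.2.1 + z.2.1 * z.2.2.1 ^ 2 + z.2.2.1 ^ 3)
          + 6 * z.1 ^ 4 * (z.2.1 ^ 4 + z.2.1 ^ 3 * z.2.2.1 + z.2.1 ^ 2 * z.2.2.1 ^ 2
            + z.2.1 * z.2.2.1 ^ 3 + z.2.2.1 ^ 4))
        + 3 / 10 * (z.1 + z.1 ^ 2 * (z.2.1 + z.2.2.1) / 2
          + z.1 ^ 3 * (z.2.1 ^ 2 + z.2.1 * z.2.2.1 + z.2.2.1 ^ 2) / 3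
          + z.1 ^ 4 * (z.2.1 ^ 3 + z.2.1 ^ 2 * z.2.2.1 + z.2.1 * z.2.2.1 ^ 2 + z.2.2.1 ^ 3) / 4)
        + 47 / 4200 * z.1 * (-2 * z.1 + z.1 ^ 2 * (z.2.1 + z.2.2.1))
        + 1 / 12000 * z.1 ^ 2 * (-4 * z.1 + 6 * z.1 ^ 2 * (z.2.1 + z.2.2.1))
        + 83723 / 291060000 * z.1 ^ 3 * (6 * z.1))) (by fun_prop)
  have hsum := (((isBigO_refl (fun x => s x ^ 5) l).mul hb1).add (hqp.mul hb2)).sub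
    ((hlog.const_mul_left (3 / 10)).congr_right (g₂ := fun x => s x ^ 5 * 1) fun x => (mul_one _).symm)
  refine (hsum.congr' ?_ ?_)
  · filter_upwards [hpos, hA] with x hx hAx
    have e : arctan x = x * (1 - s x * q x) := by
      simp only [s, q]
      field_simp
      ring
    have e2 : 3 / 2 / arctan x ^ 2 = 3 / 2 / s x / (1 - s x * q x) ^ 2 := by
      rw [e, mul_pow, ← div_div]
    have h1 := abelFun_div_sq_sub (s x) (q x) (pow_pos hx 2) hAx
    rw [abelFun_step_coeff (s x) (q x) (p x) rfl] at h1
    rw [e2, show 3 / 2 / x ^ 2 = 3 / 2 / s x from rfl, h1]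
    ring
  · refine Eventually.of_forall fun x => ?_
    simp only [s]
    ring

/-! ### Asymptotics of the iteration. -/

theorem arctan_lt_self_of_pos {x : ℝ} (hx : 0 < x) : arctan x < x := by
  have h := lt_tan (arctan_pos.2 hx) (arctan_lt_pi_div_two x)
  rwa [tan_arctan] at h

theorem arctan_iterate_pos {x : ℕ → ℝ} (hx0 : 0 < x 0) (hx : ∀ n, x (n + 1) = arctan (x n)) (n : ℕ) :
    0 < x n := by
  induction n with
  | zero => exact hx0
  | succ n ih => rw [hx]; exact arctan_pos.2 ih

theorem tendsto_arctan_iterate_zero {x : ℕ → ℝ} (hx0 : 0 < x 0)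
    (hx : ∀ n, x (n + 1) = arctan (x n)) : Tendsto x atTop (𝓝 0) := by
  have hpos := arctan_iterate_pos hx0 hx
  have hanti : Antitone x := antitone_nat_of_succ_le fun n => by
    rw [hx]; exact (arctan_lt_self_of_pos (hpos n)).le
  have hlim := tendsto_atTop_ciInf hanti ⟨0, by rintro _ ⟨n, rfl⟩; exact (hpos n).le⟩
  set c := ⨅ n, x n
  have hc : 0 ≤ c := ge_of_tendsto' hlim fun n => (hpos n).le
  have h1 : Tendsto (fun n => x (n + 1)) atTop (𝓝 (arctan c)) := by
    simp only [hx]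
    exact (continuous_arctan.tendsto c).comp hlim
  have h2 := tendsto_nhds_unique (hlim.comp (tendsto_add_atTop_nat 1)) h1
  rcases hc.eq_or_lt with h | h
  · rwa [← h] at hlim
  · exact absurd h2 (arctan_lt_self_of_pos h).ne'

theorem tendsto_abelFun_div_self : Tendsto (fun u => abelFun u / u) atTop (𝓝 1) := by
  have hinv : Tendsto (fun u : ℝ => u⁻¹) atTop (𝓝 0) := tendsto_inv_atTop_zero
  have hlog : Tendsto (fun u : ℝ => log u / u) atTop (𝓝 0) :=
    isLittleO_log_id_atTop.tendsto_div_nhds_zero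
  have h := (((hlog.const_mul (3 / 20)).const_add 1).add ((hinv.pow 2).const_mul (47 / 2800))).add
    ((hinv.pow 3).const_mul (3 / 16000)) |>.sub ((hinv.pow 4).const_mul (83723 / 86240000))
  refine (h.congr' ?_).trans_eq (by norm_num)
  filter_upwards [eventually_gt_atTop 0] with u hu
  unfold abelFun
  field_simp

theorem tendsto_arctan_iterate_coord_atTop {x : ℕ → ℝ} (hx0 : 0 < x 0)
    (hx : ∀ n, x (n + 1) = arctan (x n)) :
    Tendsto (fun n => 3 / 2 / x n ^ 2) atTop atTop := by
  have hpos := arctan_iterate_pos hx0 hx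
  have h : Tendsto (fun n => x n ^ 2) atTop (𝓝[>] 0) :=
    tendsto_nhdsWithin_iff.2 ⟨by simpa using (tendsto_arctan_iterate_zero hx0 hx).pow 2,
      Eventually.of_forall fun n => pow_pos (hpos n) 2⟩
  exact (tendsto_inv_nhdsGT_zero.comp h).const_mul_atTop (by norm_num : (0 : ℝ) < 3 / 2)

theorem abelFun_arctan_iterate_step_isBigO {x : ℕ → ℝ} (hx0 : 0 < x 0)
    (hx : ∀ n, x (n + 1) = arctan (x n)) :
    (fun n => abelFun (3 / 2 / x (n + 1) ^ 2) - abelFun (3 / 2 / x n ^ 2) - 1)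
      =O[atTop] fun n => x n ^ 10 := by
  simp only [hx]
  exact abelFun_arctan_step_isBigO.comp_tendsto
    (tendsto_nhdsWithin_iff.2 ⟨tendsto_arctan_iterate_zero hx0 hx,
      Eventually.of_forall (arctan_iterate_pos hx0 hx)⟩)

theorem tendsto_arctan_iterate_coord_div {x : ℕ → ℝ} (hx0 : 0 < x 0)
    (hx : ∀ n, x (n + 1) = arctan (x n)) :
    Tendsto (fun n : ℕ => 3 / 2 / x n ^ 2 / n) atTop (𝓝 1) := by
  have hstep : Tendsto (fun n => abelFun (3 / 2 / x (n + 1) ^ 2) - abelFun (3 / 2 / x n ^ 2))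
      atTop (𝓝 1) := by
    have h0 : Tendsto (fun n => x n ^ 10) atTop (𝓝 0) := by
      simpa using (tendsto_arctan_iterate_zero hx0 hx).pow 10
    simpa using ((abelFun_arctan_iterate_step_isBigO hx0 hx).trans_tendsto h0).add_const 1
  -- The averaged increments telescope, so `F (u n) / n → 1`; dividing by `F u / u → 1` gives `u n /
  -- n → 1`.
  have hces := hstep.cesaro
  simp only [Finset.sum_range_sub fun n => abelFun (3 / 2 / x n ^ 2)] at hces
  have hinv : Tendsto (fun n : ℕ => (n : ℝ)⁻¹ * abelFun (3 / 2 / x 0 ^ 2)) atTop (𝓝 0) := by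
    simpa using (tendsto_inv_atTop_nhds_zero_nat (𝕜 := ℝ)).mul_const (abelFun (3 / 2 / x 0 ^ 2))
  have hF : Tendsto (fun n : ℕ => (n : ℝ)⁻¹ * abelFun (3 / 2 / x n ^ 2)) atTop (𝓝 1) := by
    refine ((hces.add hinv).congr fun n => ?_).trans_eq (by norm_num)
    ring
  have hu := tendsto_arctan_iterate_coord_atTop hx0 hx
  have hr := tendsto_abelFun_div_self.comp hu
  refine ((hF.div hr one_ne_zero).congr' ?_).trans_eq (by norm_num)
  filter_upwards [hr.eventually_ne one_ne_zero, hu.eventually_gt_atTop 0] with n h1 h2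
  simp only [Function.comp_apply] at h1 ⊢
  have h3 : abelFun (3 / 2 / x n ^ 2) ≠ 0 := fun h => h1 (by rw [h, zero_div])
  simp only [Pi.div_apply, Function.comp_apply]
  generalize 3 / 2 / x n ^ 2 = u at *
  field_simp

theorem arctan_iterate_isBigO {x : ℕ → ℝ} (hx0 : 0 < x 0)
    (hx : ∀ n, x (n + 1) = arctan (x n)) :
    (fun n => x n ^ 2) =O[atTop] fun n : ℕ => (n : ℝ)⁻¹ := by
  have h := ((tendsto_arctan_iterate_coord_div hx0 hx).inv₀ one_ne_zero).isBigO_one ℝ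
  have h2 := ((h.mul (isBigO_refl (fun n : ℕ => (n : ℝ)⁻¹) atTop)).const_mul_left (3 / 2))
  refine h2.congr' ?_ (by simp)
  filter_upwards [eventually_gt_atTop 0] with n hn
  have := (arctan_iterate_pos hx0 hx n).ne'
  have : (n : ℝ) ≠ 0 := by positivity
  field_simp

/-- Along the iteration, the approximate Abel function is `n + K` up to `O(n⁻⁴)`. -/
theorem exists_abelFun_arctan_iterate_isBigO {x : ℕ → ℝ} (hx0 : 0 < x 0)
    (hx : ∀ n, x (n + 1) = arctan (x n)) :
    ∃ K : ℝ, (fun n : ℕ => abelFun (3 / 2 / x n ^ 2) - n - K) =O[atTop] fun n : ℕ => ((n : ℝ) ^ 4)⁻¹ := by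
  have hO : (fun n => abelFun (3 / 2 / x (n + 1) ^ 2) - abelFun (3 / 2 / x n ^ 2) - 1)
      =O[atTop] fun n : ℕ => (n : ℝ)⁻¹ ^ 5 := by
    refine (abelFun_arctan_iterate_step_isBigO hx0 hx).trans ?_
    simpa [← pow_mul] using (arctan_iterate_isBigO hx0 hx).pow 5
  obtain ⟨c, hc, hO⟩ := hO.exists_pos
  obtain ⟨N, hN⟩ := eventually_atTop.1 hO.bound
  have hg : Tendsto (fun n : ℕ => 8 * c * ((n : ℝ)⁻¹ ^ 4)) atTop (𝓝 0) := by
    simpa using ((tendsto_inv_atTop_nhds_zero_nat (𝕜 := ℝ)).pow 4).const_mul (8 * c)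
  obtain ⟨K, hK⟩ := exists_limit_of_abs_sub_le_telescope
    (d := fun n : ℕ => abelFun (3 / 2 / x n ^ 2) - n) (N := max N 1) hg (by
      intro n hn
      have hn1 : (1 : ℝ) ≤ n := by exact_mod_cast (le_max_right N 1).trans hn
      have h := hN n ((le_max_left N 1).trans hn)
      rw [Real.norm_eq_abs, Real.norm_of_nonneg (by positivity : (0 : ℝ) ≤ (n : ℝ)⁻¹ ^ 5)] at h
      have e : abelFun (3 / 2 / x (n + 1) ^ 2) - ((n + 1 : ℕ) : ℝ) - (abelFun (3 / 2 / x n ^ 2) - n)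
          = abelFun (3 / 2 / x (n + 1) ^ 2) - abelFun (3 / 2 / x n ^ 2) - 1 := by
        push_cast; ring
      rw [e]
      refine h.trans ?_
      push_cast
      -- The factor `8` is generous. After `n = 1 + m` the numerator has only nonnegative
      -- coefficients.
      have key : (n : ℝ)⁻¹ ^ 5 ≤ 8 * ((n : ℝ)⁻¹ ^ 4 - ((n : ℝ) + 1)⁻¹ ^ 4) := by
        have e2 : 8 * ((n : ℝ)⁻¹ ^ 4 - ((n : ℝ) + 1)⁻¹ ^ 4) - (n : ℝ)⁻¹ ^ 5 =
            (8 * n * (4 * n ^ 3 + 6 * n ^ 2 + 4 * n + 1) - (n + 1) ^ 4) / (n ^ 5 * (n + 1) ^ 4) := by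
          field_simp
          ring
        have : 0 ≤ 8 * ((n : ℝ)⁻¹ ^ 4 - ((n : ℝ) + 1)⁻¹ ^ 4) - (n : ℝ)⁻¹ ^ 5 := by
          rw [e2]
          apply div_nonneg _ (by positivity)
          obtain ⟨m, hm⟩ : ∃ m : ℝ, (n : ℝ) = 1 + m := ⟨n - 1, by ring⟩
          have hm0 : 0 ≤ m := by linarith
          rw [hm]
          ring_nf
          positivity
        linarith
      nlinarith)
  refine ⟨K, IsBigO.of_bound (8 * c) ?_⟩
  filter_upwards [eventually_ge_atTop (max N 1)] with n hn
  have h := hK n hn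
  rw [Real.norm_eq_abs, norm_inv, norm_pow, Real.norm_natCast, ← inv_pow]
  exact h

/-- The approximate Abel function expands distances at infinity by a factor at least `1 / 2`. -/
theorem exists_abs_sub_le_abelFun :
    ∃ M : ℝ, ∀ u ≥ M, ∀ v ≥ M, |u - v| ≤ 2 * |abelFun u - abelFun v| := by
  have hder : ∀ u : ℝ, 0 < u → HasDerivAt abelFun
      (1 + 3 / 20 * u⁻¹ - 47 / 2800 * u⁻¹ ^ 2 - 3 / 8000 * u⁻¹ ^ 3 + 3 * (83723 / 86240000) * u⁻¹ ^ 4)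
      u := by
    intro u hu
    have h := ((((hasDerivAt_id' u).add ((hasDerivAt_log hu.ne').const_mul (3 / 20))).add
      ((hasDerivAt_const u (47 / 2800 : ℝ)).div (hasDerivAt_id' u) hu.ne')).add
      ((hasDerivAt_const u (3 / 16000 : ℝ)).div (hasDerivAt_pow 2 u) (by positivity))).sub
      ((hasDerivAt_const u (83723 / 86240000 : ℝ)).div (hasDerivAt_pow 3 u) (by positivity))
    refine h.congr_deriv ?_
    norm_num
    field_simp
    ring
  -- For `u ≥ 1` the negative terms of the derivative total at most `47 / 2800 + 3 / 8000 < 1 / 2`.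
  have hmono : MonotoneOn (fun u => abelFun u - u / 2) (Set.Ici 1) := by
    have hd : ∀ u : ℝ, 0 < u → HasDerivAt (fun u => abelFun u - u / 2) _ u := fun u hu =>
      (hder u hu).sub ((hasDerivAt_id' u).div_const 2)
    refine monotoneOn_of_deriv_nonneg (convex_Ici 1)
      (fun u hu => (hd u (by linarith [Set.mem_Ici.1 hu])).continuousAt.continuousWithinAt)
      (fun u hu => ?_) fun u hu => ?_
    · rw [interior_Ici] at hu
      exact (hd u (by linarith [Set.mem_Ioi.1 hu])).differentiableAt.differentiableWithinAt
    · rw [interior_Ici, Set.mem_Ioi] at hu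
      rw [(hd u (by linarith)).deriv]
      have h0 : 0 ≤ u⁻¹ := by positivity
      have h1 : u⁻¹ ≤ 1 := inv_le_one_of_one_le₀ hu.le
      have h2 : u⁻¹ ^ 2 ≤ 1 := pow_le_one₀ h0 h1
      have h3 : u⁻¹ ^ 3 ≤ 1 := pow_le_one₀ h0 h1
      have h4 : 0 ≤ u⁻¹ ^ 4 := by positivity
      linarith
  have key : ∀ u ≥ (1 : ℝ), ∀ v ≥ u, |u - v| ≤ 2 * |abelFun u - abelFun v| := by
    intro u hu v hv
    have h := hmono hu (hu.le.trans hv) hv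
    simp only at h
    rw [abs_sub_comm, abs_of_nonneg (by linarith : 0 ≤ v - u), abs_sub_comm,
      abs_of_nonneg (by linarith : 0 ≤ abelFun v - abelFun u)]
    linarith
  refine ⟨1, fun u hu v hv => ?_⟩
  rcases le_total u v with h | h
  · exact key u hu v h
  · rw [abs_sub_comm, abs_sub_comm (abelFun u)]
    exact key v hv u h

/-! ### Calculus of subpolynomial sequences. -/

/-- Sequences that grow more slowly than every positive power of `n`. -/
def Subpolynomial (f : ℕ → ℝ) : Prop :=
  ∀ ε : ℝ, 0 < ε → f =o[atTop] fun n : ℕ => (n : ℝ) ^ ε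

namespace Subpolynomial

variable {f g : ℕ → ℝ}

theorem add (hf : Subpolynomial f) (hg : Subpolynomial g) : Subpolynomial fun n => f n + g n :=
  fun ε hε => (hf ε hε).add (hg ε hε)

theorem sub (hf : Subpolynomial f) (hg : Subpolynomial g) : Subpolynomial fun n => f n - g n :=
  fun ε hε => (hf ε hε).sub (hg ε hε)

theorem mul (hf : Subpolynomial f) (hg : Subpolynomial g) : Subpolynomial fun n => f n * g n := by
  intro ε hε
  refine ((hf (ε / 2) (half_pos hε)).mul (hg (ε / 2) (half_pos hε))).congr' EventuallyEq.rfl ?_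
  filter_upwards [eventually_gt_atTop 0] with n hn
  rw [← rpow_add (by exact_mod_cast hn), add_halves]

theorem of_isBigO (hg : Subpolynomial g) (h : f =O[atTop] g) : Subpolynomial f :=
  fun ε hε => h.trans_isLittleO (hg ε hε)

theorem const (c : ℝ) : Subpolynomial fun _ => c := fun _ hε =>
  isLittleO_const_left.2 (Or.inr (tendsto_norm_atTop_atTop.comp
    ((tendsto_rpow_atTop hε).comp tendsto_natCast_atTop_atTop)))

theorem of_tendsto {c : ℝ} (h : Tendsto f atTop (𝓝 c)) : Subpolynomial f :=
  (const 1).of_isBigO (h.isBigO_one ℝ)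

theorem log_natCast : Subpolynomial fun n : ℕ => log n := fun _ hε =>
  (isLittleO_log_rpow_atTop hε).comp_tendsto tendsto_natCast_atTop_atTop

theorem inv_natCast : Subpolynomial fun n : ℕ => (n : ℝ)⁻¹ :=
  of_tendsto tendsto_inv_atTop_nhds_zero_nat

theorem pow (hf : Subpolynomial f) (k : ℕ) : Subpolynomial fun n => f n ^ k := by
  induction k with
  | zero => simpa using const 1
  | succ k ih => simpa only [pow_succ] using ih.mul hf

theorem div_const (hf : Subpolynomial f) (c : ℝ) : Subpolynomial fun n => f n / c := by
  simpa only [div_eq_mul_inv] using hf.mul (const c⁻¹)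

/-- One spare factor `1 / n` absorbs all powers of `log n`. -/
theorem inv_pow_succ_mul_isLittleO (hf : Subpolynomial f) (k : ℕ) :
    (fun n : ℕ => (n : ℝ)⁻¹ ^ (k + 1) * f n) =o[atTop] fun n : ℕ => (n : ℝ)⁻¹ ^ k := by
  refine ((isBigO_refl (fun n : ℕ => (n : ℝ)⁻¹ ^ (k + 1)) atTop).mul_isLittleO
    (hf 1 one_pos)).congr' EventuallyEq.rfl ?_
  filter_upwards [eventually_gt_atTop 0] with n hn
  have : (n : ℝ) ≠ 0 := by positivity
  rw [rpow_one, pow_succ, mul_assoc, inv_mul_cancel₀ this, mul_one]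

end Subpolynomial

/-! ### Substituting the expansion into the Abel function. -/

/-- The coefficients, polynomials in `L = log n` and `C`, of the expansion in powers of `1 / n`. -/
noncomputable def arctanCoeff₁ (C L : ℝ) : ℝ := 3 / 40 * L + C / 2

noncomputable def arctanCoeff₂ (C L : ℝ) : ℝ :=
  27 / 3200 * L ^ 2 + (9 / 80 * C - 9 / 800) * L + (3 / 8 * C ^ 2 - 3 / 40 * C + 47 / 5600)

noncomputable def arctanCoeff₃ (C L : ℝ) : ℝ :=
  27 / 25600 * L ^ 3 + (27 / 1280 * C - 27 / 8000) * L ^ 2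
  + (9 / 64 * C ^ 2 - 9 / 200 * C + 1083 / 224000) * L
  + (5 / 16 * C ^ 3 - 3 / 20 * C ^ 2 + 361 / 11200 * C - 261 / 224000)

noncomputable def arctanCoeff₄ (C L : ℝ) : ℝ :=
  567 / 4096000 * L ^ 4 + (189 / 51200 * C - 1917 / 2560000) * L ^ 3
  + (189 / 5120 * C ^ 2 - 1917 / 128000 * C + 909 / 512000) * L ^ 2
  + (21 / 128 * C ^ 3 - 639 / 6400 * C ^ 2 + 303 / 12800 * C - 11979 / 8960000) * L
  + (35 / 128 * C ^ 4 - 71 / 320 * C ^ 3 + 101 / 1280 * C ^ 2 - 3993 / 448000 * C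
      - 44217 / 689920000)

/-- The expansion without its leading term, divided by `n ^ (-3 / 2)`. -/
noncomputable def arctanTail (C : ℝ) (n : ℕ) : ℝ :=
  arctanCoeff₁ C (log n) + (n : ℝ)⁻¹ * (arctanCoeff₂ C (log n)
    + (n : ℝ)⁻¹ * (arctanCoeff₃ C (log n) + (n : ℝ)⁻¹ * arctanCoeff₄ C (log n)))

theorem arctanExpansion_eq (C : ℝ) {n : ℕ} (hn : 0 < n) :
    arctanExpansion C n = ((n : ℝ) ^ (1 / 2 : ℝ))⁻¹ * (1 + (n : ℝ)⁻¹ * arctanTail C n) := by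
  have hn0 : (n : ℝ) ≠ 0 := by positivity
  have h (k : ℕ) : (n : ℝ) ^ ((1 / 2 : ℝ) + k) = (n : ℝ) ^ (1 / 2 : ℝ) * (n : ℝ) ^ k :=
    rpow_add_natCast hn0 _ _
  have h1 := h 1
  have h2 := h 2
  have h3 := h 3
  have h4 := h 4
  norm_num at h1 h2 h3 h4
  have hy : (n : ℝ) ^ (1 / 2 : ℝ) ≠ 0 := by positivity
  unfold arctanExpansion arctanTail arctanCoeff₁ arctanCoeff₂ arctanCoeff₃ arctanCoeff₄
  rw [h1, h2, h3, h4]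
  generalize (n : ℝ) ^ (1 / 2 : ℝ) = y at *
  generalize log (n : ℝ) = L at *
  field_simp
  ring

/-- These are the coefficients of `t ^ 0` to `t ^ 3`, `t = 1 / n`, in `F (v n) - n + C`. Each
equation is linear in the newest coefficient, with factor `-2`, so they determine the expansion
recursively. -/
theorem arctanCoeff_cancel (C L : ℝ) :
    -2 * arctanCoeff₁ C L + 3 / 20 * L + C = 0 ∧
    -2 * arctanCoeff₂ C L + 3 * arctanCoeff₁ C L ^ 2 - 3 / 10 * arctanCoeff₁ C L + 47 / 2800 = 0 ∧
    -2 * arctanCoeff₃ C L + 6 * arctanCoeff₁ C L * arctanCoeff₂ C L - 4 * arctanCoeff₁ C L ^ 3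
      - 3 / 10 * (arctanCoeff₂ C L - arctanCoeff₁ C L ^ 2 / 2) + 2 * (47 / 2800) * arctanCoeff₁ C L
      + 3 / 16000 = 0 ∧
    -2 * arctanCoeff₄ C L + 3 * (2 * arctanCoeff₁ C L * arctanCoeff₃ C L + arctanCoeff₂ C L ^ 2)
      - 12 * arctanCoeff₁ C L ^ 2 * arctanCoeff₂ C L + 5 * arctanCoeff₁ C L ^ 4
      - 3 / 10 * (arctanCoeff₃ C L - arctanCoeff₁ C L * arctanCoeff₂ C L + arctanCoeff₁ C L ^ 3 / 3)
      + 47 / 2800 * (2 * arctanCoeff₂ C L + arctanCoeff₁ C L ^ 2)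
      + 4 * (3 / 16000) * arctanCoeff₁ C L - 83723 / 86240000 = 0 := by
  unfold arctanCoeff₁ arctanCoeff₂ arctanCoeff₃ arctanCoeff₄
  refine ⟨?_, ?_, ?_, ?_⟩ <;> ring

/-- The terms of order at least `t ^ 4`, divided by `t ^ 4`, when the expansion is substituted into
`abelFun`. -/
noncomputable def expansionRemainder (t p₁ p₂ p₃ p₄ r₂ r₁ p w z : ℝ) : ℝ :=
  3 * (2 * p₁ * p₄ + 2 * p₂ * p₃ + t * (2 * p₂ * p₄ + p₃ ^ 2) + 2 * t ^ 2 * p₃ * p₄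
        + t ^ 3 * p₄ ^ 2)
      - 4 * (3 * p₁ * p₂ ^ 2 + t * p₂ ^ 3 + 3 * (p₁ + t * p₂) ^ 2 * r₂
        + 3 * (p₁ + t * p₂) * t ^ 2 * r₂ ^ 2 + t ^ 4 * r₂ ^ 3)
      + 5 * (r₁ * (p ^ 3 + p ^ 2 * p₁ + p * p₁ ^ 2 + p₁ ^ 3))
      - p ^ 5 * (6 + 5 * w) * z
      - 3 / 10 * (p₄ - (r₁ ^ 2 + 2 * p₁ * r₂) / 2 + r₁ * (p ^ 2 + p * p₁ + p₁ ^ 2) / 3)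
      + 47 / 2800 * (2 * r₂ + r₁ * (p + p₁))
      + 3 / 16000 * (4 * r₁ + p ^ 2 * (6 + 4 * w + w ^ 2))
      - 83723 / 86240000 * (p * (6 + 15 * w + 20 * w ^ 2 + 15 * w ^ 3 + 6 * w ^ 4 + w ^ 5))

/-- With `N = n`, `t = 1 / n`, `L = log n`, this is `F (v n) - n + C` with `log (1 + w)` replaced by
its cubic Taylor polynomial; `p`, `r₁`, `r₂` are the nested tails of the expansion. -/
theorem abelFun_expansion_identity {N t C L p₁ p₂ p₃ p₄ r₂ r₁ p w : ℝ} (hN : N * t = 1)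
    (h₂ : r₂ = p₃ + t * p₄) (h₁ : r₁ = p₂ + t * r₂) (h : p = p₁ + t * r₁) (hw : w = t * p)
    (hw1 : 1 + w ≠ 0) (c₀ : -2 * p₁ + 3 / 20 * L + C = 0)
    (c₁ : -2 * p₂ + 3 * p₁ ^ 2 - 3 / 10 * p₁ + 47 / 2800 = 0)
    (c₂ : -2 * p₃ + 6 * p₁ * p₂ - 4 * p₁ ^ 3 - 3 / 10 * (p₂ - p₁ ^ 2 / 2) + 2 * (47 / 2800) * p₁
      + 3 / 16000 = 0)
    (c₃ : -2 * p₄ + 3 * (2 * p₁ * p₃ + p₂ ^ 2) - 12 * p₁ ^ 2 * p₂ + 5 * p₁ ^ 4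
      - 3 / 10 * (p₃ - p₁ * p₂ + p₁ ^ 3 / 3) + 47 / 2800 * (2 * p₂ + p₁ ^ 2)
      + 4 * (3 / 16000) * p₁ - 83723 / 86240000 = 0) :
    N / (1 + w) ^ 2 + 3 / 20 * (L - 2 * (w - w ^ 2 / 2 + w ^ 3 / 3))
      + 47 / 2800 * (t * (1 + w) ^ 2) + 3 / 16000 * (t ^ 2 * (1 + w) ^ 4)
      - 83723 / 86240000 * (t ^ 3 * (1 + w) ^ 6) - N + C =
    t ^ 4 * expansionRemainder t p₁ p₂ p₃ p₄ r₂ r₁ p w ((1 + w) ^ 2)⁻¹ := by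
  have e : N / (1 + w) ^ 2 = N - 2 * p + 3 * (t * p ^ 2) - 4 * (t ^ 2 * p ^ 3)
      + 5 * (t ^ 3 * p ^ 4) - t ^ 4 * (p ^ 5 * (6 + 5 * w) * ((1 + w) ^ 2)⁻¹) := by
    have ht : t ≠ 0 := right_ne_zero_of_mul_eq_one hN
    have hN' : N = t⁻¹ := eq_inv_of_mul_eq_one_left hN
    have hp : p = w / t := by rw [hw]; field_simp
    rw [hN', hp]
    field_simp
    ring
  rw [e]
  unfold expansionRemainder
  subst hw h h₁ h₂
  linear_combination c₀ + t * c₁ + t ^ 2 * c₂ + t ^ 3 * c₃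

section Expansion

variable (C : ℝ)

theorem subpolynomial_arctanCoeff :
    Subpolynomial (fun n => arctanCoeff₁ C (log n)) ∧
    Subpolynomial (fun n => arctanCoeff₂ C (log n)) ∧
    Subpolynomial (fun n => arctanCoeff₃ C (log n)) ∧
    Subpolynomial (fun n => arctanCoeff₄ C (log n)) := by
  unfold arctanCoeff₁ arctanCoeff₂ arctanCoeff₃ arctanCoeff₄
  refine ⟨?_, ?_, ?_, ?_⟩ <;>
  repeat' first
    | exact Subpolynomial.const _
    | exact Subpolynomial.log_natCast
    | with_reducible apply Subpolynomial.add
    | with_reducible apply Subpolynomial.sub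
    | with_reducible apply Subpolynomial.mul
    | with_reducible apply Subpolynomial.pow

theorem subpolynomial_arctanTail : Subpolynomial (arctanTail C) := by
  obtain ⟨h₁, h₂, h₃, h₄⟩ := subpolynomial_arctanCoeff C
  have ht := Subpolynomial.inv_natCast
  exact h₁.add (ht.mul (h₂.add (ht.mul (h₃.add (ht.mul h₄)))))

theorem tendsto_inv_mul_arctanTail :
    Tendsto (fun n : ℕ => (n : ℝ)⁻¹ * arctanTail C n) atTop (𝓝 0) := by
  have h := (subpolynomial_arctanTail C).inv_pow_succ_mul_isLittleO 0
  simpa using (h.congr_right (g₂ := fun _ => (1 : ℝ)) fun n => by simp).tendsto_div_nhds_zero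

theorem abelFun_expansion_isLittleO :
    (fun n : ℕ => abelFun (n / (1 + (n : ℝ)⁻¹ * arctanTail C n) ^ 2) - n + C)
      =o[atTop] fun n : ℕ => (n : ℝ)⁻¹ ^ 3 := by
  obtain ⟨s₁, s₂, s₃, s₄⟩ := subpolynomial_arctanCoeff C
  have st := Subpolynomial.inv_natCast
  have sp := subpolynomial_arctanTail C
  have hw := tendsto_inv_mul_arctanTail C
  have sw := st.mul sp
  have hw1 : Tendsto (fun n : ℕ => 1 + (n : ℝ)⁻¹ * arctanTail C n) atTop (𝓝 1) := by
    simpa using hw.const_add 1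
  have sv : Subpolynomial fun n : ℕ => ((1 + (n : ℝ)⁻¹ * arctanTail C n) ^ 2)⁻¹ :=
    Subpolynomial.of_tendsto ((hw1.pow 2).inv₀ (by norm_num))
  have sr₂ := s₃.add (st.mul s₄)
  have sr₁ := s₂.add (st.mul sr₂)
  have hQ : Subpolynomial fun n : ℕ => expansionRemainder (n : ℝ)⁻¹ (arctanCoeff₁ C (log n))
      (arctanCoeff₂ C (log n)) (arctanCoeff₃ C (log n)) (arctanCoeff₄ C (log n))
      (arctanCoeff₃ C (log n) + (n : ℝ)⁻¹ * arctanCoeff₄ C (log n))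
      (arctanCoeff₂ C (log n)
        + (n : ℝ)⁻¹ * (arctanCoeff₃ C (log n) + (n : ℝ)⁻¹ * arctanCoeff₄ C (log n)))
      (arctanTail C n) ((n : ℝ)⁻¹ * arctanTail C n)
      ((1 + (n : ℝ)⁻¹ * arctanTail C n) ^ 2)⁻¹ := by
    unfold expansionRemainder
    repeat' first
      | with_reducible assumption
      | with_reducible exact Subpolynomial.const _
      | with_reducible apply Subpolynomial.add
      | with_reducible apply Subpolynomial.sub
      | with_reducible apply Subpolynomial.mul
      | with_reducible apply Subpolynomial.div_const
      | with_reducible apply Subpolynomial.pow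
  have hlog : (fun n : ℕ => log (1 + (n : ℝ)⁻¹ * arctanTail C n)
      - ((n : ℝ)⁻¹ * arctanTail C n - ((n : ℝ)⁻¹ * arctanTail C n) ^ 2 / 2
        + ((n : ℝ)⁻¹ * arctanTail C n) ^ 3 / 3)) =o[atTop] fun n : ℕ => (n : ℝ)⁻¹ ^ 3 := by
    have h := (log_one_add_taylor_isBigO 3).comp_tendsto hw
    refine (h.trans_isLittleO (((sp.pow 4).inv_pow_succ_mul_isLittleO 3).congr_left fun n => ?_)
      ).congr_left fun n => ?_
    · simp [mul_pow]
    · simp only [Function.comp_apply, Finset.sum_range_succ, Finset.sum_range_zero]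
      push_cast
      ring
  refine ((hQ.inv_pow_succ_mul_isLittleO 3).sub (hlog.const_mul_left (3 / 10))).congr' ?_
    EventuallyEq.rfl
  filter_upwards [eventually_gt_atTop 0, hw1.eventually_ne one_ne_zero] with n hn hn1
  have hn0 : (n : ℝ) ≠ 0 := by positivity
  obtain ⟨c₀, c₁, c₂, c₃⟩ := arctanCoeff_cancel C (log n)
  have h := abelFun_expansion_identity (mul_inv_cancel₀ hn0) rfl rfl rfl rfl hn1 c₀ c₁ c₂ c₃
  have hl : log (n / (1 + (n : ℝ)⁻¹ * arctanTail C n) ^ 2)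
      = log n - 2 * log (1 + (n : ℝ)⁻¹ * arctanTail C n) := by
    rw [log_div hn0 (pow_ne_zero 2 hn1), log_pow]; norm_num
  have hd (c : ℝ) (k : ℕ) : c / (n / (1 + (n : ℝ)⁻¹ * arctanTail C n) ^ 2) ^ k
      = c * ((n : ℝ)⁻¹ ^ k * ((1 + (n : ℝ)⁻¹ * arctanTail C n) ^ 2) ^ k) := by
    rw [div_pow, div_div_eq_mul_div, inv_pow, div_eq_mul_inv]; ring
  have hd1 := hd (47 / 2800) 1
  rw [pow_one] at hd1
  unfold abelFun
  rw [hl, hd1, hd, hd]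
  unfold arctanTail at *
  linear_combination -h

end Expansion

/-! ### Comparison of the iteration with the expansion. -/

theorem mainTheorem7 (x : ℕ → ℝ) (hx0 : 0 < x 0)
    (hx : ∀ n : ℕ, 1 ≤ n → x n = Real.arctan (x (n - 1))) :
    ∃ C : ℝ,
      (fun n : ℕ => x n / Real.sqrt (3 / 2) - arctanExpansion C n)
        =o[atTop] (fun n : ℕ => 1 / (n : ℝ) ^ (9 / 2 : ℝ)) := by
  have hx' : ∀ n, x (n + 1) = arctan (x n) := fun n => hx (n + 1) (by omega)
  obtain ⟨K, hK⟩ := exists_abelFun_arctan_iterate_isBigO hx0 hx'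
  obtain ⟨M, hM⟩ := exists_abs_sub_le_abelFun
  refine ⟨-K, ?_⟩
  set w : ℕ → ℝ := fun n => (n : ℝ)⁻¹ * arctanTail (-K) n with hwdef
  set u : ℕ → ℝ := fun n => 3 / 2 / x n ^ 2 with hu
  set v : ℕ → ℝ := fun n => n / (1 + w n) ^ 2 with hv
  have hpos := arctan_iterate_pos hx0 hx'
  have hw : Tendsto w atTop (𝓝 0) := tendsto_inv_mul_arctanTail (-K)
  have hw1 : Tendsto (fun n => 1 + w n) atTop (𝓝 1) := by simpa using hw.const_add 1
  have hw1pos : ∀ᶠ n in atTop, 0 < 1 + w n := hw1.eventually (lt_mem_nhds one_pos)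
  have huM := (tendsto_arctan_iterate_coord_atTop hx0 hx').eventually_ge_atTop M
  have hvM : ∀ᶠ n in atTop, M ≤ v n := by
    have h : Tendsto v atTop atTop := by
      have h1 : Tendsto (fun n => ((1 + w n) ^ 2)⁻¹) atTop (𝓝 1) := by
        simpa using (hw1.pow 2).inv₀ (by norm_num)
      exact (tendsto_natCast_atTop_atTop (R := ℝ)).atTop_mul_pos one_pos h1
    exact h.eventually_ge_atTop M
  have hFu : (fun n : ℕ => abelFun (u n) - n - K) =o[atTop] fun n : ℕ => (n : ℝ)⁻¹ ^ 3 := by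
    refine hK.trans_isLittleO ?_
    refine ((Subpolynomial.const 1).inv_pow_succ_mul_isLittleO 3).congr_left fun n => ?_
    rw [mul_one, inv_pow]
  have huv : (fun n => u n - v n) =o[atTop] fun n : ℕ => (n : ℝ)⁻¹ ^ 3 := by
    have h := hFu.sub (abelFun_expansion_isLittleO (-K))
    refine IsBigO.trans_isLittleO (IsBigO.of_bound 2 ?_) h
    filter_upwards [huM, hvM] with n h1 h2
    refine (hM _ h1 _ h2).trans_eq ?_
    rw [Real.norm_eq_abs]
    congr 2
    ring
  have hsq := (arctan_iterate_isBigO hx0 hx').const_mul_left (2 / 3)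
  have hE : (fun n : ℕ => ((n : ℝ) ^ (1 / 2 : ℝ))⁻¹ * (1 + w n)) =O[atTop]
      fun n : ℕ => ((n : ℝ) ^ (1 / 2 : ℝ))⁻¹ * 1 :=
    (isBigO_refl _ _).mul (hw1.isBigO_one ℝ)
  refine IsBigO.trans_isLittleO (IsBigO.of_bound 1 ?_)
    (((huv.mul_isBigO hsq).mul_isBigO hE).congr' EventuallyEq.rfl ?_)
  · filter_upwards [hw1pos, eventually_gt_atTop 0] with n h1 hn
    have hn' : (0 : ℝ) < n := by exact_mod_cast hn
    rw [arctanExpansion_eq (-K) hn, one_mul]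
    set y := (n : ℝ) ^ (1 / 2 : ℝ) with hy
    have hy0 : 0 < y := by positivity
    have hyn : y ^ 2 = n := by
      rw [hy, ← rpow_natCast, ← rpow_mul hn'.le]; norm_num
    set c := √(3 / 2) with hc
    have hc0 : 0 < c := by positivity
    have hc2 : c ^ 2 = 3 / 2 := sq_sqrt (by norm_num)
    change ‖x n / c - y⁻¹ * (1 + w n)‖ ≤ _
    set f := x n / c with hf
    have hf0 : 0 < f := div_pos (hpos n) hc0
    set e := y⁻¹ * (1 + w n) with he
    have he0 : 0 < e := by positivity
    have hfu : u n = 1 / f ^ 2 := by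
      simp only [hu, hf, div_pow, hc2]; rw [one_div_div]
    have hev : v n = 1 / e ^ 2 := by
      simp only [hv, he, mul_pow, inv_pow, hyn]
      field_simp
    have hx2 : 2 / 3 * x n ^ 2 = f ^ 2 := by rw [hf, div_pow, hc2]; ring
    rw [hx2, hfu, hev]
    -- Recovers `f - e` from `u n - v n` without expanding a square root; the last factor is at most
    -- `1`.
    have key : f - e = -((1 / f ^ 2 - 1 / e ^ 2) * f ^ 2 * e) * (e / (e + f)) := by
      field_simp
      ring
    rw [key, norm_mul, norm_neg]
    refine mul_le_of_le_one_right (norm_nonneg _) ?_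
    rw [Real.norm_of_nonneg (by positivity)]
    exact div_le_one_of_le₀ (by linarith) (by positivity)
  · filter_upwards [eventually_gt_atTop 0] with n hn
    have hn' : (n : ℝ) ≠ 0 := by positivity
    have h : (n : ℝ) ^ (9 / 2 : ℝ) = (n : ℝ) ^ (1 / 2 : ℝ) * (n : ℝ) ^ 4 := by
      rw [← rpow_add_natCast hn']; norm_num
    rw [h]
    field_simp
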